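/- Let $\gamma>0$, let $U:\mathbb R\to\mathbb R$ be a non-constant $2\pi$-periodic function of class $C^2$, and set $$-m:=\min_{[0,2\pi]}U',\qquad M:=\max_{[0,2\pi]}U'.$$ Let $E>M$ (resp. $E<-m$) and consider the equation $\ddot x+\gamma\dot x+U'(x)=E$, that is the system $$\dot x=v,\qquad \dot v=E-U'(x)-\gamma v,$$ on the cylinder $S^1\times\mathbb R$, $S^1=\mathbb R/2\pi\mathbb Z$ (a solution is written with its position $x(t)$ lifted to $\mathbb R$). For all $(x_0,v_0)\in\mathbb R^2$ there is a unique solution $(x(t),v(t))$, $t\in\mathbb R$, with $x(0)=x_0$, $v(0)=v_0$. Moreover: 1. There exists a limit cycle $\Gamma\subset S^1\times\mathbb R$ (an isolated closed orbit, i.e. an isolated image of a nonconstant periodic trajectory) that encircles the cylinder (a solution on it gains $2\pi k$, $k\in\mathbb Z\setminus\{0\}$, in position over a period), lies in the region $v>0$ (resp. $v<0$), and is globally attractive: for every solution the distance of $(x(t),v(t))$ from $\Gamma$ on the cylinder tends to $0$ as $t\to+\infty$. It is unique: the system has no closed orbit on the cylinder other than $\Gamma$. 2. $\Gamma$ is the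 graph over $S^1$ of a function $v_E$, which is the unique nowhere vanishing $2\pi$-periodic solution $v:\mathbb R\to\mathbb R$ of $$\frac{dv}{dx}=-\gamma+\frac{E-U'(x)}{v}.$$ 3. Let $\mathcal V_E:=2\pi\left[\int_0^{2\pi}\frac{dx}{v_E(x)}\right]^{-1}$. There is $\bar C>0$, depending only on $\gamma$, $U$, $E$, such that every solution with $x(0)=x_0\in[0,2\pi)$ and $\dot x(0)=v_0\in\mathbb R$ satisfies $$\left|\frac{x(t)}t-\mathcal V_E\right|\le\bar C\,\frac{(1+|v_0|)\log(e+|v_0|)}t\qquad\text{for all }t>0.$$ -/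

import Mathlib

open Set Filter Topology

namespace TiltedRatchet

/-- The phase space `S¹ × ℝ` of pairs (position, velocity), with `S¹ = ℝ / 2πℤ`. -/
abbrev Cylinder : Type := AddCircle (2 * Real.pi) × ℝ

/-- `(x, v)` is a solution, defined for all times, of `x'' + γ x' + U'(x) = E`, written as the
first order system `x' = v`, `v' = E - U'(x) - γ v`.  The position is kept on the universal cover
`ℝ` of the circle. -/
def IsSolution (γ E : ℝ) (U : ℝ → ℝ) (x v : ℝ → ℝ) : Prop :=
  ∀ t : ℝ, HasDerivAt x (v t) t ∧ HasDerivAt v (E - deriv U (x t) - γ * v t) t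

/-- The trajectory on the cylinder of a motion `(x, v)` on the universal cover. -/
noncomputable def trajectory (x v : ℝ → ℝ) (t : ℝ) : Cylinder :=
  ((x t : AddCircle (2 * Real.pi)), v t)

/-- `Γ` is a closed orbit: the image of a nonconstant time-periodic trajectory on the cylinder. -/
def IsClosedOrbit (γ E : ℝ) (U : ℝ → ℝ) (Γ : Set Cylinder) : Prop :=
  ∃ (x v : ℝ → ℝ) (T : ℝ), IsSolution γ E U x v ∧ 0 < T ∧
    (∀ t, trajectory x v (t + T) = trajectory x v t) ∧
    (∃ t, trajectory x v t ≠ trajectory x v 0) ∧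
    Γ = range (trajectory x v)

/-- A limit cycle is an isolated closed orbit. -/
def IsLimitCycle (γ E : ℝ) (U : ℝ → ℝ) (Γ : Set Cylinder) : Prop :=
  IsClosedOrbit γ E U Γ ∧
    ∃ W : Set Cylinder, IsOpen W ∧ Γ ⊆ W ∧
      ∀ Γ' : Set Cylinder, IsClosedOrbit γ E U Γ' → Γ' ⊆ W → Γ' = Γ

/-- `Γ` is an orbit of a time-periodic trajectory that winds a nonzero number `k` of times around
the cylinder during a period. -/
def Encircles (γ E : ℝ) (U : ℝ → ℝ) (Γ : Set Cylinder) : Prop :=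
  ∃ (x v : ℝ → ℝ) (T : ℝ) (k : ℤ), IsSolution γ E U x v ∧ 0 < T ∧ k ≠ 0 ∧
    (∀ t, x (t + T) = x t + k * (2 * Real.pi)) ∧ (∀ t, v (t + T) = v t) ∧
    Γ = range (trajectory x v)

/-- Every trajectory on the cylinder converges to `Γ` as `t → +∞`. -/
def IsGloballyAttractive (γ E : ℝ) (U : ℝ → ℝ) (Γ : Set Cylinder) : Prop :=
  ∀ x v : ℝ → ℝ, IsSolution γ E U x v →
    Tendsto (fun t => Metric.infDist (trajectory x v t) Γ) atTop (𝓝 0)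

/-- `w` is a `2π`-periodic solution, on the whole line, of the equation of the integral curves
`dv/dx = -γ + (E - U'(x)) / v`; in particular it never vanishes. -/
def IsPeriodicCurve (γ E : ℝ) (U : ℝ → ℝ) (w : ℝ → ℝ) : Prop :=
  Function.Periodic w (2 * Real.pi) ∧
    ∀ x : ℝ, w x ≠ 0 ∧ HasDerivAt w (-γ + (E - deriv U x) / w x) x

/-- The graph over the circle of a (`2π`-periodic) function. -/
def graphOnCylinder (w : ℝ → ℝ) : Set Cylinder :=
  range fun x : ℝ => ((x : AddCircle (2 * Real.pi)), w x)

/-- The mean velocity `2π [∫₀^{2π} dx / w(x)]⁻¹`. -/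
noncomputable def meanVelocity (w : ℝ → ℝ) : ℝ :=
  2 * Real.pi * (∫ x in (0 : ℝ)..(2 * Real.pi), 1 / w x)⁻¹

end TiltedRatchet

/-!
Write `f = E - U'`; it is periodic and of constant sign. The proof rests on one identity. If `w` is
a nowhere vanishing periodic solution of `dw/dx = -γ + f / w`, then along *every* solution `(x, v)`
of the system the deviation `r = v - w(x)` satisfies the linear equation `r' = -(f(x) / w(x)) r`
(`hasDerivAt_deviation`), and the rate `f / w` is bounded below by a positive constant
(`IsPeriodicCurve.rate_pos`, `IsPeriodicCurve.exists_rate_bounds`). So `r` decays exponentially.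
This makes the graph of `w` globally attractive, and it forces `r = 0` on any closed orbit, so that
the graph is the only one (`IsClosedOrbit.eq_graphOnCylinder`); as the graph of every periodic curve
is a closed orbit, `w` is unique as well.

With `travelTime w y = ∫₀^y ds / w(s)`, the derivative of `travelTime w (x t) - t` is `r / w(x)`,
which is integrable in time with integral of order `|r 0|` (`abs_travelTime_sub_le`). Since
`y - V * travelTime w y`, with `V` the mean velocity, is periodic, `x t - V * t` is bounded by a
multiple of `1 + |v 0|` (`exists_abs_sub_meanVelocity_mul_le`); this is the stated rate without the
logarithm.

The curve `w` is constructed for `f > 0` as the fixed point of a contraction on bounded continuous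
functions (`exists_bounded_integralCurve`), and for `f < 0` by reflection. Global solvability of the
system holds because its vector field is `C¹` and globally Lipschitz
(`exists_forall_hasDerivAt_of_lipschitzWith`).
-/

namespace TiltedRatchet

/-! ### Periodic functions and linear decay -/

theorem exists_forall_abs_le_of_periodic {g : ℝ → ℝ} {P : ℝ} (hg : Continuous g)
    (hper : Function.Periodic g P) (hP : P ≠ 0) : ∃ B, 0 < B ∧ ∀ x, |g x| ≤ B := by
  obtain ⟨B, hB, h⟩ := (hper.isBounded_of_continuous hP hg).exists_pos_norm_le
  exact ⟨B, hB, fun x => h _ (mem_range_self x)⟩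

theorem exists_pos_forall_le_of_periodic {g : ℝ → ℝ} {P : ℝ} (hg : Continuous g)
    (hper : Function.Periodic g P) (hP : P ≠ 0) (hpos : ∀ x, 0 < g x) :
    ∃ c, 0 < c ∧ ∀ x, c ≤ g x := by
  obtain ⟨c, ⟨x, rfl⟩, hc⟩ :=
    (hper.compact_of_continuous hP hg).exists_isLeast (range_nonempty g)
  exact ⟨g x, hpos x, fun y => hc (mem_range_self y)⟩

/-- A Grönwall bound for a scalar linear equation with variable rate. The lower bound `c` of the
rate may be negative. -/
theorem abs_le_mul_exp_of_hasDerivAt {κ r : ℝ → ℝ} {c : ℝ} (hc : ∀ t, c ≤ κ t)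
    (hr : ∀ t, HasDerivAt r (-κ t * r t) t) {s t : ℝ} (hst : s ≤ t) :
    |r t| ≤ |r s| * Real.exp (-c * (t - s)) := by
  have hd : ∀ u, HasDerivAt (fun u => r u ^ 2 * Real.exp (2 * c * u))
      (2 * (c - κ u) * (r u ^ 2 * Real.exp (2 * c * u))) u := by
    intro u
    have h1 := ((hr u).pow 2).mul (((hasDerivAt_id u).const_mul (2 * c)).exp)
    refine h1.congr_deriv ?_
    simp only [id, Pi.pow_apply]
    push_cast
    ring
  have hanti : Antitone (fun u => r u ^ 2 * Real.exp (2 * c * u)) := by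
    refine antitone_of_deriv_nonpos (fun u => (hd u).differentiableAt) fun u => ?_
    rw [(hd u).deriv]
    have : 0 ≤ r u ^ 2 * Real.exp (2 * c * u) := by positivity
    nlinarith [hc u]
  have h := hanti hst
  refine abs_le_of_sq_le_sq ?_ (by positivity)
  rw [mul_pow, sq_abs, ← Real.exp_nat_mul]
  have he : Real.exp (2 * c * s)
      = Real.exp (2 * (-c * (t - s))) * Real.exp (2 * c * t) := by
    rw [← Real.exp_add]; congr 1; ring
  dsimp only at h
  rw [he, ← mul_assoc] at h
  exact le_of_mul_le_mul_right h (Real.exp_pos _)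

/-! ### The exponential average and the periodic integral curve -/

/-- The average `∫_{-∞}^x exp (lam (y - x)) H y dy`: the only bounded solution of
`G' = -lam G + H` when `H` is bounded. -/
noncomputable def expAverage (lam : ℝ) (H : ℝ → ℝ) (x : ℝ) : ℝ :=
  Real.exp (-lam * x) * ∫ y in Iic x, Real.exp (lam * y) * H y

section ExpAverage

variable {lam : ℝ} {H H₁ H₂ : ℝ → ℝ} {B : ℝ}

theorem integrableOn_exp_mul_Iic_mul (hlam : 0 < lam) (hH : Continuous H) (hB : ∀ x, |H x| ≤ B)
    (x : ℝ) : MeasureTheory.IntegrableOn (fun y => Real.exp (lam * y) * H y) (Iic x) := by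
  refine MeasureTheory.Integrable.mono' ((integrableOn_exp_mul_Iic hlam x).mul_const B)
    (by fun_prop) (Eventually.of_forall fun y => ?_)
  rw [norm_mul, Real.norm_of_nonneg (Real.exp_pos _).le]
  exact mul_le_mul_of_nonneg_left (hB y) (Real.exp_pos _).le

theorem hasDerivAt_expAverage (hlam : 0 < lam) (hH : Continuous H) (hB : ∀ x, |H x| ≤ B) (x : ℝ) :
    HasDerivAt (expAverage lam H) (-lam * expAverage lam H x + H x) x := by
  have hI := integrableOn_exp_mul_Iic_mul hlam hH hB
  have hsplit : ∀ z, (∫ y in Iic z, Real.exp (lam * y) * H y)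
      = (∫ y in Iic 0, Real.exp (lam * y) * H y) + ∫ y in (0 : ℝ)..z, Real.exp (lam * y) * H y := by
    intro z
    rw [← intervalIntegral.integral_Iic_sub_Iic (hI 0) (hI z)]
    ring
  have hcont : Continuous fun y => Real.exp (lam * y) * H y := by fun_prop
  have h1 : HasDerivAt (fun z => ∫ y in Iic z, Real.exp (lam * y) * H y)
      (Real.exp (lam * x) * H x) x := by
    rw [funext hsplit]
    exact (hcont.integral_hasStrictDerivAt 0 x).hasDerivAt.const_add _
  have h2 := (((hasDerivAt_id x).const_mul (-lam)).exp).mul h1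
  have he : Real.exp (-lam * x) * Real.exp (lam * x) = 1 := by
    rw [← Real.exp_add]; simp
  refine h2.congr_deriv ?_
  simp only [id, expAverage]
  linear_combination H x * he

theorem expAverage_mono (hlam : 0 < lam) (h₁ : Continuous H₁) (h₂ : Continuous H₂)
    (hB₁ : ∀ x, |H₁ x| ≤ B) {B' : ℝ} (hB₂ : ∀ x, |H₂ x| ≤ B') (hle : ∀ x, H₁ x ≤ H₂ x) (x : ℝ) :
    expAverage lam H₁ x ≤ expAverage lam H₂ x := by
  refine mul_le_mul_of_nonneg_left ?_ (Real.exp_pos _).le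
  exact MeasureTheory.integral_mono (integrableOn_exp_mul_Iic_mul hlam h₁ hB₁ x)
    (integrableOn_exp_mul_Iic_mul hlam h₂ hB₂ x)
    fun y => mul_le_mul_of_nonneg_left (hle y) (Real.exp_pos _).le

theorem expAverage_add_const (hlam : 0 < lam) (hH : Continuous H) (hB : ∀ x, |H x| ≤ B)
    (d x : ℝ) : expAverage lam (fun y => H y + d) x = expAverage lam H x + d / lam := by
  have he : Real.exp (-lam * x) * Real.exp (lam * x) = 1 := by
    rw [← Real.exp_add]; simp
  unfold expAverage
  simp_rw [mul_add]
  rw [MeasureTheory.integral_add (integrableOn_exp_mul_Iic_mul hlam hH hB x)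
    ((integrableOn_exp_mul_Iic hlam x).mul_const d), MeasureTheory.integral_mul_const,
    integral_exp_mul_Iic hlam]
  linear_combination (d / lam) * he

theorem expAverage_const (hlam : 0 < lam) (d x : ℝ) : expAverage lam (fun _ => d) x = d / lam := by
  have h := expAverage_add_const (H := fun _ => 0) hlam continuous_const (B := 0) (by simp) d x
  simpa [expAverage] using h

end ExpAverage

/-- For a positive bounded forcing, the equation of the integral curves has a bounded solution on
the whole line: it is a fixed point of `u ↦ expAverage lam (lam u - γ + f / u)`, which is a
contraction, and preserves the band `a / γ ≤ u ≤ b / γ`, once `lam` is large. -/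
theorem exists_bounded_integralCurve {γ a b : ℝ} (hγ : 0 < γ) (ha : 0 < a) {f : ℝ → ℝ}
    (hf : Continuous f) (hfa : ∀ x, a ≤ f x) (hfb : ∀ x, f x ≤ b) :
    ∃ w : ℝ → ℝ, ∀ x, w x ∈ Icc (a / γ) (b / γ) ∧ HasDerivAt w (-γ + f x / w x) x := by
  have hab : a ≤ b := (hfa 0).trans (hfb 0)
  have hb : 0 < b := ha.trans_le hab
  set α := a / γ with hα
  set β := b / γ with hβ
  have hα0 : 0 < α := by positivity
  have hβ0 : 0 < β := by positivity
  have hαβ : α ≤ β := by rw [hα, hβ]; gcongr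
  -- `lam` bounds `f / u ^ 2` on the band, so that `u ↦ lam u + f / u` is increasing there
  set lam := b / α ^ 2 with hlam
  have hlam0 : 0 < lam := by positivity
  let c : ℝ → ℝ := fun u => max α (min u β)
  have hcα : ∀ u, α ≤ c u := fun u => le_max_left _ _
  have hcβ : ∀ u, c u ≤ β := fun u => max_le hαβ (min_le_right _ _)
  have hc0 : ∀ u, 0 < c u := fun u => hα0.trans_le (hcα u)
  have hcc : Continuous c := by fun_prop
  have hcl : ∀ u u', |c u - c u'| ≤ |u - u'| := by
    intro u u'
    simp only [c]
    grind
  let h : ℝ → ℝ → ℝ := fun y p => lam * p - γ + f y / p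
  have hdiff : ∀ y p q, 0 < p → 0 < q → h y p - h y q = (lam - f y / (p * q)) * (p - q) := by
    intro y p q hp hq
    simp only [h]
    field_simp
    ring
  have hquot_le : ∀ y p q, α ≤ p → α ≤ q → f y / (p * q) ≤ lam := by
    intro y p q hp hq
    have := hα0.le.trans hp
    rw [hlam, pow_two]
    gcongr
    exact hfb y
  have hquot_ge : ∀ y p q, 0 < p → 0 < q → p ≤ β → q ≤ β → a / β ^ 2 ≤ f y / (p * q) := by
    intro y p q hp hq hp' hq'
    rw [pow_two]
    gcongr
    · exact ha.le.trans (hfa y)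
    · exact hfa y
  have hhα : ∀ y p, α ≤ p → lam * α ≤ h y p := by
    intro y p hp
    have h1 := hdiff y p α (hα0.trans_le hp) hα0
    have h2 := hquot_le y p α hp le_rfl
    have h3 : γ ≤ f y / α := by
      rw [le_div_iff₀ hα0, hα, mul_div_cancel₀ _ hγ.ne']
      exact hfa y
    have h4 : h y α = lam * α - γ + f y / α := rfl
    nlinarith [mul_nonneg (sub_nonneg.2 h2) (sub_nonneg.2 hp)]
  have hhβ : ∀ y p, α ≤ p → p ≤ β → h y p ≤ lam * β := by
    intro y p hp hp'
    have h1 := hdiff y β p hβ0 (hα0.trans_le hp)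
    have h2 := hquot_le y β p hαβ hp
    have h3 : f y / β ≤ γ := by
      rw [div_le_iff₀ hβ0, hβ, mul_div_cancel₀ _ hγ.ne']
      exact hfb y
    have h4 : h y β = lam * β - γ + f y / β := rfl
    nlinarith [mul_nonneg (sub_nonneg.2 h2) (sub_nonneg.2 hp')]
  let N : (ℝ → ℝ) → ℝ → ℝ := fun u y => h y (c (u y))
  have hNc : ∀ u, Continuous u → Continuous (N u) := by
    intro u hu
    simp only [N, h]
    have : Continuous fun y => c (u y) := hcc.comp hu
    exact ((continuous_const.mul this).sub continuous_const).add
      (hf.div this fun y => (hc0 _).ne')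
  have hNα : ∀ u y, lam * α ≤ N u y := fun u y => hhα _ _ (hcα _)
  have hNβ : ∀ u y, N u y ≤ lam * β := fun u y => hhβ _ _ (hcα _) (hcβ _)
  have hNb : ∀ u y, |N u y| ≤ lam * β := by
    intro u y
    rw [abs_of_nonneg ((by positivity : (0 : ℝ) ≤ lam * α).trans (hNα u y))]
    exact hNβ u y
  have hGα : ∀ u, Continuous u → ∀ x, α ≤ expAverage lam (N u) x := by
    intro u hu x
    have := expAverage_mono hlam0 continuous_const (hNc u hu) (fun _ => le_rfl) (hNb u) (hNα u) x
    rwa [expAverage_const hlam0, mul_div_cancel_left₀ _ hlam0.ne'] at this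
  have hGβ : ∀ u, Continuous u → ∀ x, expAverage lam (N u) x ≤ β := by
    intro u hu x
    have := expAverage_mono hlam0 (hNc u hu) continuous_const (hNb u) (fun _ => le_rfl) (hNβ u) x
    rwa [expAverage_const hlam0, mul_div_cancel_left₀ _ hlam0.ne'] at this
  have hGd : ∀ u, Continuous u → ∀ x,
      HasDerivAt (expAverage lam (N u)) (-lam * expAverage lam (N u) x + N u x) x :=
    fun u hu => hasDerivAt_expAverage hlam0 (hNc u hu) (hNb u)
  let T : BoundedContinuousFunction ℝ ℝ → BoundedContinuousFunction ℝ ℝ := fun u =>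
    BoundedContinuousFunction.ofNormedAddCommGroup (expAverage lam (N u))
      (continuous_iff_continuousAt.2 fun x => (hGd u u.continuous x).continuousAt) β fun x => by
        rw [Real.norm_of_nonneg (hα0.le.trans (hGα u u.continuous x))]
        exact hGβ u u.continuous x
  have hTa : ∀ u x, T u x = expAverage lam (N u) x := fun _ _ => rfl
  have haβ : a / β ^ 2 ≤ lam :=
    (hquot_ge 0 α α hα0 hα0 hαβ hαβ).trans (hquot_le 0 α α le_rfl le_rfl)
  have hNlip : ∀ (u u' : BoundedContinuousFunction ℝ ℝ) y,
      |N u y - N u' y| ≤ (lam - a / β ^ 2) * dist u u' := by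
    intro u u' y
    simp only [N]
    rw [hdiff _ _ _ (hc0 _) (hc0 _), abs_mul]
    have h1 := hquot_le y (c (u y)) (c (u' y)) (hcα _) (hcα _)
    have h2 := hquot_ge y (c (u y)) (c (u' y)) (hc0 _) (hc0 _) (hcβ _) (hcβ _)
    have h3 : |u y - u' y| ≤ dist u u' := by
      rw [← Real.dist_eq]; exact BoundedContinuousFunction.dist_coe_le_dist y
    refine mul_le_mul ?_ ((hcl _ _).trans h3) (abs_nonneg _) (by linarith)
    rw [abs_of_nonneg (by linarith)]
    linarith
  have hTlip1 : ∀ (u u' : BoundedContinuousFunction ℝ ℝ) x,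
      T u x - T u' x ≤ (lam - a / β ^ 2) * dist u u' / lam := by
    intro u u' x
    rw [hTa, hTa, sub_le_iff_le_add', ← expAverage_add_const hlam0 (hNc u' u'.continuous) (hNb u')]
    refine expAverage_mono hlam0 (hNc u u.continuous) ((hNc u' u'.continuous).add continuous_const)
      (hNb u) (B' := lam * β + |(lam - a / β ^ 2) * dist u u'|)
      (fun y => (abs_add_le _ _).trans (by gcongr; exact hNb u' y)) (fun y => ?_) x
    exact sub_le_iff_le_add'.1 (abs_le.1 (hNlip u u' y)).2
  have hK0 : 0 ≤ (lam - a / β ^ 2) / lam := div_nonneg (by linarith) hlam0.le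
  have hTcontr : ContractingWith ⟨(lam - a / β ^ 2) / lam, hK0⟩ T := by
    refine ⟨?_, LipschitzWith.of_dist_le_mul fun u u' => ?_⟩
    · change (lam - a / β ^ 2) / lam < 1
      rw [div_lt_one hlam0]
      have : 0 < a / β ^ 2 := by positivity
      linarith
    · change dist (T u) (T u') ≤ (lam - a / β ^ 2) / lam * dist u u'
      rw [div_mul_eq_mul_div]
      refine (BoundedContinuousFunction.dist_le
        (div_nonneg (mul_nonneg (by linarith) dist_nonneg) hlam0.le)).2 fun x => ?_
      rw [Real.dist_eq, abs_le]
      have h1 := hTlip1 u u' x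
      have h2 := hTlip1 u' u x
      rw [dist_comm] at h2
      constructor <;> linarith
  let u := ContractingWith.fixedPoint T hTcontr
  have hu : T u = u := hTcontr.fixedPoint_isFixedPt
  have hux : ∀ x, u x = expAverage lam (N u) x := fun x => by rw [← hTa, hu]
  have hmem : ∀ x, u x ∈ Icc α β := fun x => by
    rw [hux]; exact ⟨hGα u u.continuous x, hGβ u u.continuous x⟩
  refine ⟨u, fun x => ⟨hmem x, ?_⟩⟩
  have h1 := hGd u u.continuous x
  have h2 : expAverage lam (N u) = u := funext fun x => (hux x).symm
  rw [h2] at h1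
  convert h1 using 1
  have h3 : c (u x) = u x := by
    simp only [c]
    rw [min_eq_left (hmem x).2, max_eq_right (hmem x).1]
  simp only [N, h, h3]
  ring

/-- The bounded integral curve over a periodic positive forcing is periodic: it differs from its
translate by a bounded solution of a linear equation whose nonzero solutions blow up at `-∞`. -/
theorem exists_periodic_integralCurve {γ P : ℝ} (hγ : 0 < γ) (hP : P ≠ 0) {f : ℝ → ℝ}
    (hf : Continuous f) (hper : Function.Periodic f P) (hpos : ∀ x, 0 < f x) :
    ∃ w : ℝ → ℝ, Function.Periodic w P ∧ ∀ x, w x ≠ 0 ∧ HasDerivAt w (-γ + f x / w x) x := by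
  obtain ⟨a, ha, hfa⟩ := exists_pos_forall_le_of_periodic hf hper hP hpos
  obtain ⟨b, hb, hfb⟩ := exists_forall_abs_le_of_periodic hf hper hP
  obtain ⟨w, hw⟩ := exists_bounded_integralCurve hγ ha hf hfa fun x => (le_abs_self _).trans (hfb x)
  set α := a / γ
  set β := b / γ
  have hα0 : 0 < α := by positivity
  have hβ0 : 0 < β := by positivity
  have hw0 : ∀ x, 0 < w x := fun x => hα0.trans_le (hw x).1.1
  refine ⟨w, fun x => ?_, fun x => ⟨(hw0 x).ne', (hw x).2⟩⟩
  set D : ℝ → ℝ := fun x => w (x + P) - w x with hD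
  have hDd : ∀ x, HasDerivAt D (-(f x / (w (x + P) * w x)) * D x) x := by
    intro x
    have h := ((hw (x + P)).2.comp_add_const x P).sub (hw x).2
    refine h.congr_deriv ?_
    rw [hper x]
    simp only [hD]
    have := (hw0 x).ne'
    have := (hw0 (x + P)).ne'
    field_simp
    ring
  have hc : ∀ x, a / β ^ 2 ≤ f x / (w (x + P) * w x) := by
    intro x
    have := hw0 x
    have := hw0 (x + P)
    rw [pow_two]
    gcongr
    · exact (hpos x).le
    · exact hfa x
    · exact (hw (x + P)).1.2
    · exact (hw x).1.2
  have hDb : ∀ s, |D s| ≤ β := fun s =>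
    abs_le.2 ⟨by linarith [hw0 (s + P), (hw s).1.2], by linarith [hw0 s, (hw (s + P)).1.2]⟩
  have hlim : Tendsto (fun n : ℝ => β * Real.exp (-(a / β ^ 2) * n)) atTop (𝓝 0) := by
    have : Tendsto (fun n : ℝ => -(a / β ^ 2) * n) atTop atBot :=
      tendsto_id.const_mul_atTop_of_neg (neg_lt_zero.2 (by positivity))
    simpa using (Real.tendsto_exp_atBot.comp this).const_mul β
  have hle : |D x| ≤ 0 := by
    refine ge_of_tendsto hlim ((eventually_ge_atTop 0).mono fun n hn => ?_)
    have h := abs_le_mul_exp_of_hasDerivAt hc hDd (sub_le_self x hn)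
    rw [sub_sub_cancel] at h
    exact h.trans (by gcongr; exact hDb _)
  have := abs_nonpos_iff.1 hle
  simp only [hD] at this
  linarith

/-! ### The initial value problem -/

/-- A globally Lipschitz `C¹` vector field is complete. The existence time of the Picard–Lindelöf
theorem can be taken the same at all points: on the ball of radius `‖Z p‖ / K` around `p` the field
is at most `2 ‖Z p‖`, so that time `1 / (2 K)` is available. -/
theorem exists_forall_hasDerivAt_of_lipschitzWith {F : Type*} [NormedAddCommGroup F]
    [NormedSpace ℝ F] [CompleteSpace F] {Z : F → F} (hZ : ContDiff ℝ 1 Z) {K : NNReal}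
    (hK : LipschitzWith K Z) (p : F) :
    ∃ c : ℝ → F, c 0 = p ∧ ∀ t, HasDerivAt c (Z (c t)) t := by
  wlog hK0 : 0 < K generalizing K
  · exact this (hK.weaken (le_add_of_nonneg_right zero_le_one : K ≤ K + 1)) (by positivity)
  have hK0' : (0 : ℝ) < K := hK0
  have hε : (0 : ℝ) < 1 / (2 * K) := by positivity
  have key := exists_isMIntegralCurve_of_isMIntegralCurveOn (I := modelWithCornersSelf ℝ F)
    (M := F) (v := Z) (contMDiff_vectorSpace_iff_contDiff.2 hZ) hε (fun q => ?_) p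
  · obtain ⟨c, hc0, hc⟩ := key
    refine ⟨c, hc0, fun t => ?_⟩
    have h : HasFDerivAt c ((1 : ℝ →L[ℝ] ℝ).smulRight (Z (c t))) t :=
      hasMFDerivAt_iff_hasFDerivAt.1 (hc t)
    exact h.hasDerivAt.congr_deriv (by simp)
  · have hpl : IsPicardLindelof (fun _ => Z)
        (⟨0, by constructor <;> linarith⟩ : Icc (-(1 / (2 * K)) : ℝ) (1 / (2 * K)))
        q (‖Z q‖₊ / K) 0 (2 * ‖Z q‖₊) K := by
      refine IsPicardLindelof.of_time_independent (fun y hy => ?_) hK.lipschitzOnWith ?_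
      · have h1 : ‖Z y - Z q‖ ≤ K * dist y q := by rw [← dist_eq_norm]; exact hK.dist_le_mul y q
        have h2 : K * dist y q ≤ ‖Z q‖ := by
          have : dist y q ≤ ‖Z q‖ / K := by simpa using hy
          rwa [le_div_iff₀' hK0'] at this
        have h3 : ‖Z y‖ ≤ ‖Z y - Z q‖ + ‖Z q‖ := by simpa using norm_add_le (Z y - Z q) (Z q)
        push_cast
        linarith
      · push_cast
        rw [sub_zero, zero_sub, neg_neg, max_self, sub_zero]
        apply le_of_eq
        field_simp
    obtain ⟨c, hc0, hc⟩ := hpl.exists_eq_forall_mem_Icc_hasDerivWithinAt₀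
    refine ⟨c, hc0, fun t ht => ?_⟩
    exact ((hc t (Ioo_subset_Icc_self ht)).mono Ioo_subset_Icc_self).hasFDerivWithinAt.hasMFDerivWithinAt

section

variable {γ E P : ℝ} {U : ℝ → ℝ}

theorem periodic_deriv (hper : Function.Periodic U P) :
    Function.Periodic (deriv U) P := fun x => by
  rw [← deriv_comp_add_const, funext hper]

theorem lipschitzWith_deriv_of_periodic (hU : ContDiff ℝ 2 U) (hper : Function.Periodic U P)
    (hP : P ≠ 0) : ∃ K, LipschitzWith K (deriv U) := by
  have h1 : ContDiff ℝ 1 (deriv U) := hU.iterate_deriv' 1 1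
  have hp : Function.Periodic (deriv (deriv U)) P := periodic_deriv (periodic_deriv hper)
  obtain ⟨B, hB⟩ := (hp.isBounded_of_continuous hP (h1.continuous_deriv le_rfl)).exists_norm_le
  refine ⟨B.toNNReal, lipschitzWith_of_nnnorm_deriv_le (h1.differentiable one_ne_zero) fun x => ?_⟩
  exact NNReal.le_toNNReal_of_coe_le (hB _ (mem_range_self x))

theorem existsUnique_isSolution (hU : ContDiff ℝ 2 U) (hper : Function.Periodic U P) (hP : P ≠ 0)
    (x₀ v₀ : ℝ) :
    ∃! p : (ℝ → ℝ) × (ℝ → ℝ), IsSolution γ E U p.1 p.2 ∧ p.1 0 = x₀ ∧ p.2 0 = v₀ := by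
  obtain ⟨K, hK⟩ := lipschitzWith_deriv_of_periodic hU hper hP
  have h1 : ContDiff ℝ 1 (deriv U) := hU.iterate_deriv' 1 1
  let Z : ℝ × ℝ → ℝ × ℝ := fun p => (p.2, E - deriv U p.1 - γ * p.2)
  have hZ : ContDiff ℝ 1 Z := by
    refine contDiff_snd.prodMk ((contDiff_const.sub (h1.comp contDiff_fst)).sub
      (contDiff_const.mul contDiff_snd))
  obtain ⟨L, hL⟩ : ∃ L, LipschitzWith L Z :=
    ⟨_, LipschitzWith.prod_snd.prodMk (((LipschitzWith.const E).sub (hK.comp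
      LipschitzWith.prod_fst)).sub ((lipschitzWith_smul γ).comp LipschitzWith.prod_snd))⟩
  have hiff : ∀ x v : ℝ → ℝ, IsSolution γ E U x v ↔
      ∀ t, HasDerivAt (fun t => (x t, v t)) (Z (x t, v t)) t := fun x v =>
    forall_congr' fun t => ⟨fun h => h.1.prodMk h.2, fun h =>
      ⟨h.hasFDerivAt.fst.hasDerivAt.congr_deriv (by simp [Z]),
       h.hasFDerivAt.snd.hasDerivAt.congr_deriv (by simp [Z])⟩⟩
  obtain ⟨c, hc0, hc⟩ := exists_forall_hasDerivAt_of_lipschitzWith hZ hL (x₀, v₀)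
  refine ⟨(fun t => (c t).1, fun t => (c t).2), ⟨(hiff _ _).2 hc, by simp [hc0], by simp [hc0]⟩, ?_⟩
  rintro ⟨x, v⟩ ⟨hs, hx, hv⟩
  have heq : (fun t => (x t, v t)) = c :=
    ODE_solution_unique_univ (v := fun _ => Z) (s := fun _ => univ) (t₀ := 0)
      (fun _ => hL.lipschitzOnWith) (fun t => ⟨(hiff x v).1 hs t, mem_univ _⟩)
      (fun t => ⟨hc t, mem_univ _⟩) (by simp only [hc0]; exact Prod.ext hx hv)
  subst heq
  rfl

end

section

variable {γ E : ℝ} {U w x v : ℝ → ℝ}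

theorem continuous_deriv_of_contDiff_two (hU : ContDiff ℝ 2 U) : Continuous (deriv U) :=
  hU.continuous_deriv (by norm_num)

/-! ### Integral curves -/

theorem IsPeriodicCurve.continuous (hw : IsPeriodicCurve γ E U w) : Continuous w :=
  continuous_iff_continuousAt.2 fun x => (hw.2 x).2.continuousAt

/-- The quotient `(E - U') / w`, which will be the rate of attraction, has constant sign; a negative
sign would make `w` strictly decreasing, against periodicity. -/
theorem IsPeriodicCurve.rate_pos (hγ : 0 < γ) (hU : ContDiff ℝ 2 U)
    (hE : ∀ x, E - deriv U x ≠ 0) (hw : IsPeriodicCurve γ E U w) (x : ℝ) :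
    0 < (E - deriv U x) / w x := by
  have hc : Continuous fun x => (E - deriv U x) / w x :=
    (continuous_const.sub (continuous_deriv_of_contDiff_two hU)).div hw.continuous
      fun x => (hw.2 x).1
  have hne : ∀ x, (E - deriv U x) / w x ≠ 0 := fun x => div_ne_zero (hE x) (hw.2 x).1
  by_contra! hx
  have hneg : ∀ y, (E - deriv U y) / w y < 0 := by
    intro y
    by_contra! hy
    obtain ⟨z, hz⟩ := mem_range_of_exists_le_of_exists_ge hc ⟨x, hx⟩ ⟨y, hy⟩
    exact hne z hz
  have hanti : StrictAnti w := strictAnti_of_deriv_neg fun y => by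
    rw [(hw.2 y).2.deriv]
    linarith [hneg y]
  have := hanti (lt_add_of_pos_right 0 Real.two_pi_pos)
  rw [hw.1 0] at this
  exact lt_irrefl _ this

/-- For negative forcing the curve is obtained from the positive one by the reflection
`(x, v) ↦ (-x, -v)`. -/
theorem exists_isPeriodicCurve (hγ : 0 < γ) (hU : ContDiff ℝ 2 U)
    (hper : Function.Periodic U (2 * Real.pi))
    (hE : (∀ x, 0 < E - deriv U x) ∨ ∀ x, E - deriv U x < 0) :
    ∃ w, IsPeriodicCurve γ E U w := by
  have hc : Continuous fun x => E - deriv U x :=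
    continuous_const.sub (continuous_deriv_of_contDiff_two hU)
  have hp : ∀ x, deriv U (x + 2 * Real.pi) = deriv U x := periodic_deriv hper
  rcases hE with hE | hE
  · exact exists_periodic_integralCurve hγ Real.two_pi_pos.ne' hc (fun x => by rw [hp]) hE
  · obtain ⟨w, hwp, hw⟩ := exists_periodic_integralCurve hγ Real.two_pi_pos.ne'
      (f := fun x => -(E - deriv U (-x))) (hc.comp continuous_neg).neg
      (fun x => by
        change -(E - deriv U (-(x + 2 * Real.pi))) = -(E - deriv U (-x))
        rw [← hp (-(x + 2 * Real.pi)), neg_add, neg_add_cancel_right])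
      (fun x => neg_pos.2 (hE _))
    refine ⟨fun x => -w (-x), fun x => ?_, fun x => ⟨neg_ne_zero.2 (hw _).1, ?_⟩⟩
    · change -w (-(x + 2 * Real.pi)) = -w (-x)
      rw [← hwp (-(x + 2 * Real.pi)), neg_add, neg_add_cancel_right]
    · have h := ((hw (-x)).2.scomp x (hasDerivAt_neg x)).neg
      refine h.congr_deriv ?_
      rw [neg_neg, smul_eq_mul, neg_one_mul, neg_neg, div_neg, neg_div]

/-! ### Deviation from an integral curve -/

/-- The deviation `v - w(x)` from the curve obeys a homogeneous linear equation along every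
solution, whatever the sign of `v`. -/
theorem hasDerivAt_deviation (hw : IsPeriodicCurve γ E U w) (hs : IsSolution γ E U x v) (t : ℝ) :
    HasDerivAt (fun t => v t - w (x t))
      (-((E - deriv U (x t)) / w (x t)) * (v t - w (x t))) t := by
  have h := (hs t).2.sub ((hw.2 (x t)).2.comp t (hs t).1)
  refine h.congr_deriv ?_
  have := (hw.2 (x t)).1
  field_simp
  ring

theorem IsPeriodicCurve.exists_rate_bounds (hγ : 0 < γ) (hU : ContDiff ℝ 2 U)
    (hper : Function.Periodic U (2 * Real.pi)) (hE : ∀ x, E - deriv U x ≠ 0)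
    (hw : IsPeriodicCurve γ E U w) :
    ∃ c C, 0 < c ∧ ∀ x, c ≤ (E - deriv U x) / w x ∧ (E - deriv U x) / w x ≤ C := by
  have hc : Continuous fun x => (E - deriv U x) / w x :=
    (continuous_const.sub (continuous_deriv_of_contDiff_two hU)).div hw.continuous
      fun x => (hw.2 x).1
  have hp : Function.Periodic (fun x => (E - deriv U x) / w x) (2 * Real.pi) := fun x => by
    simp only [hw.1 x, periodic_deriv hper x]
  obtain ⟨c, hc0, hcle⟩ := exists_pos_forall_le_of_periodic hc hp Real.two_pi_pos.ne'
    (hw.rate_pos hγ hU hE)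
  obtain ⟨C, -, hC⟩ := exists_forall_abs_le_of_periodic hc hp Real.two_pi_pos.ne'
  exact ⟨c, C, hc0, fun x => ⟨hcle x, (le_abs_self _).trans (hC x)⟩⟩

theorem deviation_eq_zero {C : ℝ} (hC : ∀ x, (E - deriv U x) / w x ≤ C) {c : ℝ}
    (hc : ∀ x, c ≤ (E - deriv U x) / w x) (hw : IsPeriodicCurve γ E U w)
    (hs : IsSolution γ E U x v) (h0 : v 0 = w (x 0)) (t : ℝ) : v t = w (x t) := by
  have hd := hasDerivAt_deviation hw hs
  rcases le_total 0 t with ht | ht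
  · have h := abs_le_mul_exp_of_hasDerivAt (fun t => hc (x t)) hd ht
    rw [h0, sub_self, abs_zero, zero_mul, abs_nonpos_iff] at h
    linarith
  · have hd' : ∀ s, HasDerivAt (fun s => v (-s) - w (x (-s)))
        (-(-((E - deriv U (x (-s))) / w (x (-s)))) * (v (-s) - w (x (-s)))) s := fun s =>
      ((hd (-s)).scomp s (hasDerivAt_neg s)).congr_deriv (by rw [smul_eq_mul]; ring)
    have h := abs_le_mul_exp_of_hasDerivAt (fun s => neg_le_neg (hC (x (-s)))) hd'
      (neg_nonneg.2 ht)
    simp only [neg_zero, h0, sub_self, abs_zero, zero_mul, neg_neg, abs_nonpos_iff] at h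
    linarith

/-! ### Travel time along the curve -/

/-- The signed time needed to move from `0` to `y` along the curve `v = w(x)`. -/
noncomputable def travelTime (w : ℝ → ℝ) (y : ℝ) : ℝ := ∫ s in (0 : ℝ)..y, 1 / w s

theorem IsPeriodicCurve.continuous_inv (hw : IsPeriodicCurve γ E U w) :
    Continuous fun s => 1 / w s :=
  continuous_const.div hw.continuous fun x => (hw.2 x).1

theorem hasDerivAt_travelTime (hw : IsPeriodicCurve γ E U w) (y : ℝ) :
    HasDerivAt (travelTime w) (1 / w y) y :=
  (hw.continuous_inv.integral_hasStrictDerivAt 0 y).hasDerivAt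

theorem travelTime_injective (hw : IsPeriodicCurve γ E U w) :
    Function.Injective (travelTime w) := by
  have key : ∀ a b, a < b → travelTime w a ≠ travelTime w b := fun a b hab heq => by
    obtain ⟨c, -, hc⟩ := exists_hasDerivAt_eq_zero hab
      (fun y _ => (hasDerivAt_travelTime hw y).continuousAt.continuousWithinAt) heq
      fun y _ => hasDerivAt_travelTime hw y
    exact one_div_ne_zero (hw.2 c).1 hc
  intro a b h
  rcases lt_trichotomy a b with hab | hab | hab
  · exact absurd h (key a b hab)
  · exact hab
  · exact absurd h.symm (key b a hab)

theorem travelTime_add_two_pi (hw : IsPeriodicCurve γ E U w) (y : ℝ) :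
    travelTime w (y + 2 * Real.pi) = travelTime w y + travelTime w (2 * Real.pi) := by
  have hp : Function.Periodic (fun s => 1 / w s) (2 * Real.pi) := fun s => by
    simp only [hw.1 s]
  have hi : ∀ a b, IntervalIntegrable (fun s => 1 / w s) MeasureTheory.volume a b :=
    fun a b => hw.continuous_inv.intervalIntegrable a b
  unfold travelTime
  rw [← intervalIntegral.integral_add_adjacent_intervals (hi 0 y) (hi y _),
    hp.intervalIntegral_add_eq y 0, zero_add]

theorem travelTime_two_pi_ne_zero (hw : IsPeriodicCurve γ E U w) :
    travelTime w (2 * Real.pi) ≠ 0 := fun h =>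
  Real.two_pi_pos.ne' (travelTime_injective hw (h.trans intervalIntegral.integral_same.symm))

/-- The travel time measures time up to the relative deviation from the curve. -/
theorem hasDerivAt_travelTime_comp (hw : IsPeriodicCurve γ E U w) (hs : IsSolution γ E U x v)
    (t : ℝ) : HasDerivAt (fun t => travelTime w (x t) - t) ((v t - w (x t)) / w (x t)) t := by
  refine (((hasDerivAt_travelTime hw (x t)).comp t (hs t).1).sub (hasDerivAt_id t)).congr_deriv ?_
  have := (hw.2 (x t)).1
  field_simp

theorem travelTime_comp_eq (hw : IsPeriodicCurve γ E U w) (hs : IsSolution γ E U x v)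
    (hv : ∀ t, v t = w (x t)) (t : ℝ) : travelTime w (x t) = travelTime w (x 0) + t := by
  have h : ∀ t, HasDerivAt (fun t => travelTime w (x t) - t) 0 t := fun t =>
    (hasDerivAt_travelTime_comp hw hs t).congr_deriv (by simp [hv t])
  have := is_const_of_deriv_eq_zero (fun t => (h t).differentiableAt) (fun t => (h t).deriv) t 0
  linarith

/-- A solution lying over the curve moves along the whole curve. -/
theorem range_trajectory_eq_graph (hw : IsPeriodicCurve γ E U w) (hs : IsSolution γ E U x v)
    (hv : ∀ t, v t = w (x t)) : range (trajectory x v) = graphOnCylinder w := by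
  apply Subset.antisymm
  · rintro _ ⟨t, rfl⟩
    exact ⟨x t, by simp only [trajectory, hv t]⟩
  · rintro _ ⟨y, rfl⟩
    refine ⟨travelTime w y - travelTime w (x 0), ?_⟩
    have : x (travelTime w y - travelTime w (x 0)) = y := travelTime_injective hw (by
      rw [travelTime_comp_eq hw hs hv]; ring)
    simp only [trajectory, hv, this]

/-! ### The closed orbit -/

theorem coe_eq_coe_iff_exists {a b : ℝ} :
    (a : AddCircle (2 * Real.pi)) = b ↔ ∃ n : ℤ, b + n * (2 * Real.pi) = a := by
  rw [← sub_eq_zero, ← AddCircle.coe_sub, AddCircle.coe_eq_zero_iff]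
  refine exists_congr fun n => ?_
  rw [zsmul_eq_mul]
  constructor <;> intro h <;> linarith

theorem IsPeriodicCurve.eq_of_coe_eq (hw : IsPeriodicCurve γ E U w) {a b : ℝ}
    (h : (a : AddCircle (2 * Real.pi)) = b) : w a = w b := by
  obtain ⟨n, rfl⟩ := coe_eq_coe_iff_exists.1 h
  exact hw.1.int_mul n b

theorem exists_solution_on_curve (hγ : 0 < γ) (hU : ContDiff ℝ 2 U)
    (hper : Function.Periodic U (2 * Real.pi)) (hE : ∀ x, E - deriv U x ≠ 0)
    (hw : IsPeriodicCurve γ E U w) :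
    ∃ x v, IsSolution γ E U x v ∧ x 0 = 0 ∧ ∀ t, v t = w (x t) := by
  obtain ⟨⟨x, v⟩, ⟨hs, hx, hv⟩, -⟩ :=
    existsUnique_isSolution (γ := γ) (E := E) hU hper Real.two_pi_pos.ne' 0 (w 0)
  obtain ⟨c, C, -, hb⟩ := hw.exists_rate_bounds hγ hU hper hE
  exact ⟨x, v, hs, hx, deviation_eq_zero (fun x => (hb x).2) (fun x => (hb x).1) hw hs
    (by simp only at hx hv; rw [hx, hv])⟩

/-- The period is `|travelTime w (2π)|`, and the orbit winds once, in the direction of the sign of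
`travelTime w (2π)`. -/
theorem encircles_graphOnCylinder (hγ : 0 < γ) (hU : ContDiff ℝ 2 U)
    (hper : Function.Periodic U (2 * Real.pi)) (hE : ∀ x, E - deriv U x ≠ 0)
    (hw : IsPeriodicCurve γ E U w) : Encircles γ E U (graphOnCylinder w) := by
  obtain ⟨x, v, hs, hx, hv⟩ := exists_solution_on_curve hγ hU hper hE hw
  have hadd : ∀ t, x (t + travelTime w (2 * Real.pi)) = x t + 2 * Real.pi := fun t =>
    travelTime_injective hw (by
      rw [travelTime_add_two_pi hw, travelTime_comp_eq hw hs hv, travelTime_comp_eq hw hs hv t]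
      ring)
  have hsub : ∀ t, x (t + -travelTime w (2 * Real.pi)) = x t - 2 * Real.pi := fun t => by
    have := hadd (t + -travelTime w (2 * Real.pi))
    rw [neg_add_cancel_right] at this
    linarith
  have hr := (range_trajectory_eq_graph hw hs hv).symm
  rcases (travelTime_two_pi_ne_zero hw).lt_or_gt with hT | hT
  · exact ⟨x, v, _, -1, hs, neg_pos.2 hT, by norm_num,
      fun t => by rw [hsub]; push_cast; ring, fun t => by rw [hv, hv, hsub, hw.1.sub_eq], hr⟩
  · exact ⟨x, v, _, 1, hs, hT, by norm_num,
      fun t => by rw [hadd]; push_cast; ring, fun t => by rw [hv, hv, hadd, hw.1], hr⟩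

theorem isClosedOrbit_graphOnCylinder (hγ : 0 < γ) (hU : ContDiff ℝ 2 U)
    (hper : Function.Periodic U (2 * Real.pi)) (hE : ∀ x, E - deriv U x ≠ 0)
    (hw : IsPeriodicCurve γ E U w) : IsClosedOrbit γ E U (graphOnCylinder w) := by
  obtain ⟨x, v, T, k, hs, hT, -, hxT, hvT, hr⟩ := encircles_graphOnCylinder hγ hU hper hE hw
  refine ⟨x, v, T, hs, hT, fun t => ?_, ?_, hr⟩
  · exact Prod.ext (coe_eq_coe_iff_exists.2 ⟨k, (hxT t).symm⟩) (hvT t)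
  · -- an orbit equal to the whole graph has points over both `0` and `π`
    by_contra! hconst
    have h : ∀ p ∈ graphOnCylinder w, p = trajectory x v 0 := by
      rw [hr]
      rintro _ ⟨t, rfl⟩
      exact hconst t
    have h1 := (h _ ⟨Real.pi, rfl⟩).trans (h _ ⟨0, rfl⟩).symm
    obtain ⟨n, hn⟩ := coe_eq_coe_iff_exists.1 (congrArg Prod.fst h1)
    have h2 : (n : ℝ) * 2 = 1 := by
      refine mul_right_cancel₀ Real.pi_pos.ne' ?_
      linarith
    have h3 : n * 2 = 1 := by exact_mod_cast h2
    omega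

/-- On a closed orbit the deviation is periodic as well as decaying, so that it vanishes. -/
theorem IsClosedOrbit.eq_graphOnCylinder (hγ : 0 < γ) (hU : ContDiff ℝ 2 U)
    (hper : Function.Periodic U (2 * Real.pi)) (hE : ∀ x, E - deriv U x ≠ 0)
    (hw : IsPeriodicCurve γ E U w) {Γ : Set Cylinder} (hΓ : IsClosedOrbit γ E U Γ) :
    Γ = graphOnCylinder w := by
  obtain ⟨x, v, T, hs, hT, htr, -, rfl⟩ := hΓ
  obtain ⟨c, C, hc0, hb⟩ := hw.exists_rate_bounds hγ hU hper hE
  refine range_trajectory_eq_graph hw hs fun t => ?_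
  have h := abs_le_mul_exp_of_hasDerivAt (fun t => (hb (x t)).1) (hasDerivAt_deviation hw hs)
    (le_add_of_nonneg_right hT.le : t ≤ t + T)
  have h1 : w (x (t + T)) = w (x t) := hw.eq_of_coe_eq (congrArg Prod.fst (htr t))
  have h2 : v (t + T) = v t := congrArg Prod.snd (htr t)
  rw [h1, h2, add_sub_cancel_left] at h
  have h3 : Real.exp (-c * T) < 1 := Real.exp_lt_one_iff.2 (by nlinarith)
  have h4 : |v t - w (x t)| = 0 := by nlinarith [abs_nonneg (v t - w (x t))]
  linarith [abs_eq_zero.1 h4]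

theorem IsPeriodicCurve.unique (hγ : 0 < γ) (hU : ContDiff ℝ 2 U)
    (hper : Function.Periodic U (2 * Real.pi)) (hE : ∀ x, E - deriv U x ≠ 0) {w' : ℝ → ℝ}
    (hw : IsPeriodicCurve γ E U w) (hw' : IsPeriodicCurve γ E U w') : w' = w := by
  have h := (isClosedOrbit_graphOnCylinder hγ hU hper hE hw').eq_graphOnCylinder hγ hU hper hE hw
  funext x
  have hx : ((x : AddCircle (2 * Real.pi)), w' x) ∈ graphOnCylinder w := h ▸ mem_range_self x
  obtain ⟨y, hy⟩ := hx
  rw [← hw.eq_of_coe_eq (congrArg Prod.fst hy)]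
  exact (congrArg Prod.snd hy).symm

theorem isGloballyAttractive_graphOnCylinder (hγ : 0 < γ) (hU : ContDiff ℝ 2 U)
    (hper : Function.Periodic U (2 * Real.pi)) (hE : ∀ x, E - deriv U x ≠ 0)
    (hw : IsPeriodicCurve γ E U w) : IsGloballyAttractive γ E U (graphOnCylinder w) := by
  intro x v hs
  obtain ⟨c, C, hc0, hb⟩ := hw.exists_rate_bounds hγ hU hper hE
  have hlim : Tendsto (fun t => |v 0 - w (x 0)| * Real.exp (-c * (t - 0))) atTop (𝓝 0) := by
    simp_rw [sub_zero]
    have : Tendsto (fun t => -c * t) atTop atBot :=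
      tendsto_id.const_mul_atTop_of_neg (neg_lt_zero.2 hc0)
    simpa using (Real.tendsto_exp_atBot.comp this).const_mul |v 0 - w (x 0)|
  refine squeeze_zero' (Eventually.of_forall fun t => Metric.infDist_nonneg)
    ((eventually_ge_atTop 0).mono fun t ht => ?_) hlim
  refine le_trans ?_ (abs_le_mul_exp_of_hasDerivAt (fun t => (hb (x t)).1)
    (hasDerivAt_deviation hw hs) ht)
  refine (Metric.infDist_le_dist_of_mem
    (mem_range_self (f := fun y : ℝ => ((y : AddCircle (2 * Real.pi)), w y)) (x t))).trans ?_
  simp [trajectory, Prod.dist_eq, Real.dist_eq]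

/-! ### Convergence of the mean velocity -/

/-- The deviation decays exponentially and so has a finite time integral, proportional to its
initial value. -/
theorem abs_travelTime_sub_le {c d : ℝ} (hc0 : 0 < c) (hc : ∀ x, c ≤ (E - deriv U x) / w x)
    (hd0 : 0 < d) (hd : ∀ x, d ≤ |w x|) (hw : IsPeriodicCurve γ E U w)
    (hs : IsSolution γ E U x v) {t : ℝ} (ht : 0 ≤ t) :
    |travelTime w (x t) - t - travelTime w (x 0)| ≤ |v 0 - w (x 0)| / (d * c) := by
  set R := |v 0 - w (x 0)|
  have hR : 0 ≤ R := abs_nonneg _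
  have hq := fun s => (hasDerivAt_travelTime_comp hw hs s).sub_const (travelTime w (x 0))
  have hB : ∀ s, HasDerivAt (fun s => R / (d * c) * (1 - Real.exp (-c * s)))
      (R / d * Real.exp (-c * s)) s := fun s => by
    refine (((((hasDerivAt_id s).const_mul (-c)).exp).const_sub 1).const_mul
      (R / (d * c))).congr_deriv ?_
    simp only [id]
    field_simp
  have h := image_norm_le_of_norm_deriv_right_le_deriv_boundary (a := 0) (b := t)
    (fun s _ => (hq s).continuousAt.continuousWithinAt) (fun s _ => (hq s).hasDerivWithinAt)
    (by simp) hB (fun s hs' => ?_) (right_mem_Icc.2 ht)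
  · rw [Real.norm_eq_abs] at h
    refine h.trans (mul_le_of_le_one_right (by positivity) ?_)
    linarith [Real.exp_pos (-c * t)]
  · have h1 := abs_le_mul_exp_of_hasDerivAt (fun t => hc (x t)) (hasDerivAt_deviation hw hs) hs'.1
    rw [sub_zero] at h1
    rw [norm_div, Real.norm_eq_abs, Real.norm_eq_abs, div_mul_eq_mul_div]
    exact div_le_div₀ (by positivity) h1 hd0 (hd _)

theorem exists_abs_sub_meanVelocity_mul_le (hγ : 0 < γ) (hU : ContDiff ℝ 2 U)
    (hper : Function.Periodic U (2 * Real.pi)) (hE : ∀ x, E - deriv U x ≠ 0)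
    (hw : IsPeriodicCurve γ E U w) :
    ∃ C, 0 < C ∧ ∀ x v : ℝ → ℝ, IsSolution γ E U x v → x 0 ∈ Ico 0 (2 * Real.pi) →
      ∀ t, 0 ≤ t → |x t - meanVelocity w * t| ≤ C * (1 + |v 0|) := by
  obtain ⟨c, C, hc0, hb⟩ := hw.exists_rate_bounds hγ hU hper hE
  obtain ⟨W, hW0, hW⟩ := exists_forall_abs_le_of_periodic hw.continuous hw.1 Real.two_pi_pos.ne'
  obtain ⟨d, hd0, hd⟩ := exists_pos_forall_le_of_periodic hw.continuous.abs
    (fun x => by simp only [hw.1 x]) Real.two_pi_pos.ne' fun x => abs_pos.2 (hw.2 x).1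
  set V := meanVelocity w with hV
  have hVT : V * travelTime w (2 * Real.pi) = 2 * Real.pi := by
    have h := travelTime_two_pi_ne_zero hw
    unfold travelTime at h ⊢
    rw [hV, meanVelocity, mul_assoc, inv_mul_cancel₀ h, mul_one]
  -- position and `V` times travel time differ by a periodic, hence bounded, function
  set D : ℝ → ℝ := fun y => y - V * travelTime w y with hD
  have hDc : Continuous D := continuous_id.sub (continuous_const.mul
    (continuous_iff_continuousAt.2 fun y => (hasDerivAt_travelTime hw y).continuousAt))
  have hDp : Function.Periodic D (2 * Real.pi) := fun y => by
    simp only [hD, travelTime_add_two_pi hw]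
    linear_combination -hVT
  obtain ⟨B, hB0, hB⟩ := exists_forall_abs_le_of_periodic hDc hDp Real.two_pi_pos.ne'
  have hpi := Real.two_pi_pos
  set A := |V| / (d * c) with hA
  have hA0 : 0 ≤ A := by positivity
  refine ⟨2 * B + 2 * Real.pi + A * (1 + W), by positivity, fun x v hs hx t ht => ?_⟩
  have h1 := abs_travelTime_sub_le hc0 (fun x => (hb x).1) hd0 hd hw hs ht
  have h2 : |v 0 - w (x 0)| ≤ |v 0| + W :=
    (abs_sub _ _).trans (by gcongr; exact hW _)
  have h3 : x t - V * t = D (x t) - D (x 0) + x 0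
      + V * (travelTime w (x t) - t - travelTime w (x 0)) := by
    simp only [hD]
    ring
  have h4 : |V * (travelTime w (x t) - t - travelTime w (x 0))| ≤ A * (|v 0| + W) := by
    rw [abs_mul]
    calc |V| * |travelTime w (x t) - t - travelTime w (x 0)|
        ≤ |V| * ((|v 0| + W) / (d * c)) := by gcongr; exact h1.trans (by gcongr)
      _ = A * (|v 0| + W) := by rw [hA]; ring
  have h5 := abs_le.1 h4
  have h6 := abs_le.1 (hB (x t))
  have h7 := abs_le.1 (hB (x 0))
  have h8 : 2 * B + 2 * Real.pi + A * (|v 0| + W)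
      ≤ (2 * B + 2 * Real.pi + A * (1 + W)) * (1 + |v 0|) := by
    have : 0 ≤ |v 0| := abs_nonneg _
    have e1 : 0 ≤ (2 * B + 2 * Real.pi) * |v 0| := by positivity
    have e2 : 0 ≤ A * W * |v 0| := by positivity
    linarith
  rw [h3]
  refine le_trans (abs_le.2 ⟨?_, ?_⟩) h8
  · linarith [hx.1]
  · linarith [hx.2]

end

end TiltedRatchet

theorem proposition2p1 (γ : ℝ) (hγ : 0 < γ) (U : ℝ → ℝ) (hU : ContDiff ℝ 2 U)
    (hper : Function.Periodic U (2 * Real.pi)) (hnc : ∃ a b : ℝ, U a ≠ U b)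
    (m M : ℝ)
    (hm : IsLeast (deriv U '' Icc 0 (2 * Real.pi)) (-m))
    (hM : IsGreatest (deriv U '' Icc 0 (2 * Real.pi)) M)
    (E : ℝ) (hE : M < E ∨ E < -m) :
    -- the initial value problem is well posed, globally in time
    (∀ x₀ v₀ : ℝ, ∃! p : (ℝ → ℝ) × (ℝ → ℝ),
      TiltedRatchet.IsSolution γ E U p.1 p.2 ∧ p.1 0 = x₀ ∧ p.2 0 = v₀) ∧
    ∃ (Γ : Set TiltedRatchet.Cylinder) (vE : ℝ → ℝ),
      -- the limit cycle
      TiltedRatchet.IsLimitCycle γ E U Γ ∧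
      TiltedRatchet.Encircles γ E U Γ ∧
      TiltedRatchet.IsGloballyAttractive γ E U Γ ∧
      (∀ Γ' : Set TiltedRatchet.Cylinder, TiltedRatchet.IsClosedOrbit γ E U Γ' → Γ' = Γ) ∧
      (M < E → ∀ p ∈ Γ, 0 < p.2) ∧
      (E < -m → ∀ p ∈ Γ, p.2 < 0) ∧
      -- it is the graph of the unique periodic integral curve
      Γ = TiltedRatchet.graphOnCylinder vE ∧
      TiltedRatchet.IsPeriodicCurve γ E U vE ∧
      (∀ w : ℝ → ℝ, TiltedRatchet.IsPeriodicCurve γ E U w → w = vE) ∧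
      -- convergence of the time-averaged velocity
      ∃ C : ℝ, 0 < C ∧ ∀ x v : ℝ → ℝ, TiltedRatchet.IsSolution γ E U x v →
        x 0 ∈ Ico 0 (2 * Real.pi) → ∀ t : ℝ, 0 < t →
          |x t / t - TiltedRatchet.meanVelocity vE| ≤
            C * ((1 + |v 0|) * Real.log (Real.exp 1 + |v 0|) / t) := by
  open TiltedRatchet in
  refine ⟨existsUnique_isSolution hU hper Real.two_pi_pos.ne', ?_⟩
  have hmem : ∀ x, deriv U x ∈ deriv U '' Icc 0 (2 * Real.pi) := fun x => by
    obtain ⟨y, hy, hxy⟩ := (periodic_deriv hper).exists_mem_Ico₀ Real.two_pi_pos x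
    exact ⟨y, Ico_subset_Icc_self hy, hxy.symm⟩
  have hpos : M < E → ∀ x, 0 < E - deriv U x := fun h x => by linarith [hM.2 (hmem x)]
  have hneg : E < -m → ∀ x, E - deriv U x < 0 := fun h x => by linarith [hm.2 (hmem x)]
  have hE' := hE.imp hpos hneg
  have hne : ∀ x, E - deriv U x ≠ 0 := fun x =>
    hE'.elim (fun h => (h x).ne') fun h => (h x).ne
  obtain ⟨w, hw⟩ := exists_isPeriodicCurve hγ hU hper hE'
  have hrate := hw.rate_pos hγ hU hne
  have huniq : ∀ Γ', IsClosedOrbit γ E U Γ' → Γ' = graphOnCylinder w := fun Γ' h =>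
    h.eq_graphOnCylinder hγ hU hper hne hw
  obtain ⟨C, hC0, hC⟩ := exists_abs_sub_meanVelocity_mul_le hγ hU hper hne hw
  refine ⟨graphOnCylinder w, w, ⟨isClosedOrbit_graphOnCylinder hγ hU hper hne hw, univ,
    isOpen_univ, subset_univ _, fun Γ' h _ => huniq Γ' h⟩,
    encircles_graphOnCylinder hγ hU hper hne hw,
    isGloballyAttractive_graphOnCylinder hγ hU hper hne hw, huniq, ?_, ?_, rfl, hw,
    fun w' hw' => hw.unique hγ hU hper hne hw', C, hC0, fun x v hs hx t ht => ?_⟩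
  · rintro h _ ⟨x, rfl⟩
    exact (div_pos_iff_of_pos_left (hpos h x)).1 (hrate x)
  · rintro h _ ⟨x, rfl⟩
    rcases div_pos_iff.1 (hrate x) with h' | h'
    · exact absurd h'.1 (hneg h x).not_gt
    · exact h'.2
  · have hlog : 1 ≤ Real.log (Real.exp 1 + |v 0|) := by
      rw [Real.le_log_iff_exp_le (by positivity)]
      exact le_add_of_nonneg_right (abs_nonneg _)
    have heq : x t / t - meanVelocity w = (x t - meanVelocity w * t) / t := by
      field_simp
    rw [heq, abs_div, abs_of_pos ht, ← mul_div_assoc]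
    gcongr
    refine (hC x v hs hx t ht.le).trans ?_
    gcongr
    exact le_mul_of_one_le_right (by positivity) hlog
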